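/- Let $R$ be a finite commutative ring with unity, and let $L(R)$ be the set of nonzero zero divisors of $R$, that is, of the elements $x \neq 0$ of $R$ such that $xy = 0$ for some $y \neq 0$ in $R$. Let $Z(R)$ be the zero-divisor graph of $R$: its vertex set is $L(R)$, and two distinct vertices $x, y$ are adjacent if and only if $xy = 0$. Suppose that $|L(R)| \geq 3$, that $Z(R)$ has a cut vertex (that is, $Z(R)$ is connected and has a vertex whose removal leaves two or more connected components), and that $Z(R)$ has no vertex of degree $1$. Then $Mdim(Z(R)) = \infty$. Here, for a finite connected graph $G$ and $B \subseteq V(G)$, the multiset representation of a vertex $v$ with respect to $B$ is the multiset $\{d(v,b) : b \in B\}$ of distances, counted with multiplicity; $B$ is a multiset resolving set of $G$ if any two distinct vertices of $G$ have different multiset representations with respect to $B$; and $Mdim(G)$ is the least cardinality of a multiset resolving set of $G$, with $Mdim(G) = \infty$ if $G$ has none. -/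

import Mathlib

/-- The set `L(R)` of nonzero zero divisors of a commutative ring `R`; these are the vertices of
the zero-divisor graph. -/
def nonzeroZeroDivisors (R : Type*) [CommRing R] : Set R :=
  {x | x ≠ 0 ∧ ∃ y : R, y ≠ 0 ∧ x * y = 0}

/-- The zero-divisor graph `Z(R)`: its vertices are the nonzero zero divisors of `R`, and two
distinct vertices are adjacent when their product is zero. -/
def zeroDivisorGraph (R : Type*) [CommRing R] : SimpleGraph (nonzeroZeroDivisors R) where
  Adj x y := x ≠ y ∧ (x : R) * (y : R) = 0
  symm := ⟨fun x y h => ⟨h.1.symm, by rw [mul_comm]; exact h.2⟩⟩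
  loopless := ⟨fun _ h => h.1 rfl⟩

namespace SimpleGraph

variable {V : Type*}

/-- `v` is a cut vertex of the connected graph `G`: deleting `v` leaves at least two connected
components. -/
def IsCutVertex (G : SimpleGraph V) (v : V) : Prop :=
  G.Connected ∧ ¬ (G.induce {v}ᶜ).Preconnected

/-- The multiset representation of `v` with respect to `B`: the multiset of the distances from `v`
to the vertices of `B`, with multiplicities. -/
noncomputable def multisetRep (G : SimpleGraph V) (B : Finset V) (v : V) : Multiset ℕ :=
  B.val.map (fun b => G.dist v b)

/-- `B` is a multiset resolving set: distinct vertices of `G`, inside or outside `B`, have distinct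
multiset representations with respect to `B`. -/
def IsMultisetResolving (G : SimpleGraph V) (B : Finset V) : Prop :=
  ∀ u v : V, u ≠ v → G.multisetRep B u ≠ G.multisetRep B v

/-- The multiset dimension of a finite connected graph: the least cardinality of a multiset
resolving set, and `⊤` if there is none. -/
noncomputable def multisetDim (G : SimpleGraph V) : ℕ∞ :=
  sInf {n : ℕ∞ | ∃ B : Finset V, G.IsMultisetResolving B ∧ (B.card : ℕ∞) = n}

end SimpleGraph

/-! Let `x` be the cut vertex. With no leaves, each other vertex has a neighbour other than `x`,
necessarily on its own side, and a nonzero element killing vertices from both sides must be `x`.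
Hence opposite sides multiply to `x`, and from this `x * x = 0`, `x + x = 0`, and `x` kills every
zero divisor. So `x` is a universal vertex, distances are at most 2, and `p`, `p + x` are twins: a
resolving `B` contains exactly one of them. Annihilators are so small (`eq_or_eq_add`) that two
elements of `B` still get equal representations. -/

namespace SimpleGraph

variable {V : Type*} {G : SimpleGraph V}

/-- In a graph with a universal vertex, distances to `b` depend only on adjacency to `b`. -/
theorem dist_eq_dist_of_adj_iff {z s t b : V} (hz : ∀ v, v ≠ z → G.Adj z v)
    (hs : s ≠ b) (ht : t ≠ b) (h : G.Adj s b ↔ G.Adj t b) : G.dist s b = G.dist t b := by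
  have two : ∀ v, v ≠ b → ¬ G.Adj v b → G.dist v b = 2 := by
    intro v hv hvb
    have hvz : v ≠ z := by
      rintro rfl
      exact hvb (hz b hv.symm)
    have hbz : b ≠ z := by
      rintro rfl
      exact hvb (hz v hv).symm
    let p : G.Walk v b := .cons (hz v hvz).symm (.cons (hz b hbz) .nil)
    have h2 : G.dist v b ≤ 2 := G.dist_le p
    have h0 : G.dist v b ≠ 0 := fun h0 => hv ((Reachable.dist_eq_zero_iff ⟨p⟩).1 h0)
    have h1 : G.dist v b ≠ 1 := fun h1 => hvb (dist_eq_one_iff_adj.1 h1)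
    omega
  by_cases hsb : G.Adj s b
  · rw [dist_eq_one_iff_adj.2 hsb, dist_eq_one_iff_adj.2 (h.1 hsb)]
  · rw [two s hs hsb, two t ht (fun h' => hsb (h.2 h'))]

/-- Two vertices, both inside or both outside `B`, which have the same distances to the other
elements of `B`, have the same multiset representation. -/
theorem multisetRep_eq_of_dist_eq {B : Finset V} {s t : V} (hst : s ≠ t)
    (hB : s ∈ B ↔ t ∈ B) (h : ∀ b ∈ B, b ≠ s → b ≠ t → G.dist s b = G.dist t b) :
    G.multisetRep B s = G.multisetRep B t := by
  classical
  unfold multisetRep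
  by_cases hs : s ∈ B
  · have ht : t ∈ B.val.erase s := (Multiset.mem_erase_of_ne hst.symm).2 (hB.1 hs)
    have hnd : (B.val.erase s).Nodup := B.nodup.erase s
    -- When both lie in `B`, the elements `s` and `t` contribute `0` and the same distance `d(s, t)`
    -- to each side.
    rw [← Multiset.cons_erase (show s ∈ B.val from hs), ← Multiset.cons_erase ht]
    simp only [Multiset.map_cons, dist_self]
    rw [Multiset.cons_swap, G.dist_comm (u := s) (v := t)]
    congr 2
    refine Multiset.map_congr rfl fun b hb => ?_
    obtain ⟨hbt, hb'⟩ := hnd.mem_erase_iff.1 hb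
    obtain ⟨hbs, hbB⟩ := B.nodup.mem_erase_iff.1 hb'
    exact h b hbB hbs hbt
  · refine Multiset.map_congr rfl fun b hb => h b hb ?_ ?_
    · rintro rfl
      exact hs hb
    · rintro rfl
      exact hs (hB.2 hb)

end SimpleGraph

/-- A splitting, by the predicate `A`, of the nonzero zero divisors other than `x` into two
nonempty parts such that no product across the parts vanishes, where moreover each such
zero divisor is annihilated by another one. -/
structure IsZeroDivisorSplit {R : Type*} [CommRing R] (x : R) (A : R → Prop) : Prop where
  ne_zero : x ≠ 0
  iff_of_mul : ∀ p ∈ nonzeroZeroDivisors R, p ≠ x → ∀ q ∈ nonzeroZeroDivisors R, q ≠ x →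
    p * q = 0 → (A p ↔ A q)
  exists_mem : ∃ p ∈ nonzeroZeroDivisors R, p ≠ x ∧ A p
  exists_notMem : ∃ p ∈ nonzeroZeroDivisors R, p ≠ x ∧ ¬ A p
  exists_mul : ∀ p ∈ nonzeroZeroDivisors R, p ≠ x →
    ∃ q ∈ nonzeroZeroDivisors R, q ≠ x ∧ q ≠ p ∧ p * q = 0

/-! ### Algebra of the cut vertex. -/

namespace IsZeroDivisorSplit

variable {R : Type*} [CommRing R] {x : R} {A : R → Prop}

theorem exists_opposite (h : IsZeroDivisorSplit x A) (p : R) :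
    ∃ q ∈ nonzeroZeroDivisors R, q ≠ x ∧ ¬ (A p ↔ A q) := by
  obtain ⟨u, hu, hux, hAu⟩ := h.exists_mem
  obtain ⟨w, hw, hwx, hAw⟩ := h.exists_notMem
  by_cases hp : A p
  · exact ⟨w, hw, hwx, by tauto⟩
  · exact ⟨u, hu, hux, by tauto⟩

theorem eq_zero_or_eq (h : IsZeroDivisorSplit x A) {p q z : R}
    (hp : p ∈ nonzeroZeroDivisors R) (hpx : p ≠ x) (hq : q ∈ nonzeroZeroDivisors R) (hqx : q ≠ x)
    (hpq : ¬ (A p ↔ A q)) (hzp : z * p = 0) (hzq : z * q = 0) : z = 0 ∨ z = x := by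
  by_contra! hz
  have hzV : z ∈ nonzeroZeroDivisors R := ⟨hz.1, p, hp.1, hzp⟩
  exact hpq ((h.iff_of_mul z hzV hz.2 p hp hpx hzp).symm.trans
    (h.iff_of_mul z hzV hz.2 q hq hqx hzq))

/-- Neighbours of `p` and of `q` lie on opposite sides, and both kill `p * q`. -/
theorem mul_opposite (h : IsZeroDivisorSplit x A) {p q : R}
    (hp : p ∈ nonzeroZeroDivisors R) (hpx : p ≠ x) (hq : q ∈ nonzeroZeroDivisors R) (hqx : q ≠ x)
    (hpq : ¬ (A p ↔ A q)) : p * q = x := by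
  obtain ⟨p', hp', hpx', -, hpp⟩ := h.exists_mul p hp hpx
  obtain ⟨q', hq', hqx', -, hqq⟩ := h.exists_mul q hq hqx
  have h1 := h.iff_of_mul p hp hpx p' hp' hpx' hpp
  have h2 := h.iff_of_mul q hq hqx q' hq' hqx' hqq
  refine (h.eq_zero_or_eq hp' hpx' hq' hqx' (by tauto) ?_ ?_).resolve_left
    fun h0 => hpq (h.iff_of_mul p hp hpx q hq hqx h0)
  · linear_combination q * hpp
  · linear_combination p * hqq

/-- Write `x = u * w` across the sides; then neighbours of `u` and of `w` kill `r * x`. -/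
theorem mul_self_eq_zero_or (h : IsZeroDivisorSplit x A) (r : R) : r * x = 0 ∨ r * x = x := by
  obtain ⟨u, hu, hux, -⟩ := h.exists_mem
  obtain ⟨w, hw, hwx, huw⟩ := h.exists_opposite u
  have hx := h.mul_opposite hu hux hw hwx huw
  obtain ⟨p', hp', hpx', -, hpp⟩ := h.exists_mul u hu hux
  obtain ⟨q', hq', hqx', -, hqq⟩ := h.exists_mul w hw hwx
  have h1 := h.iff_of_mul u hu hux p' hp' hpx' hpp
  have h2 := h.iff_of_mul w hw hwx q' hq' hqx' hqq
  refine h.eq_zero_or_eq hp' hpx' hq' hqx' (by tauto) ?_ ?_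
  · linear_combination r * w * hpp - r * p' * hx
  · linear_combination r * u * hqq - r * q' * hx

/-- If `x` were idempotent, `1 - x` would be a vertex whose annihilator is contained in `{0, x}`,
contradicting `exists_mul`. -/
theorem sq_eq_zero (h : IsZeroDivisorSplit x A) : x * x = 0 := by
  refine (h.mul_self_eq_zero_or x).resolve_right fun hxx => ?_
  have hV : 1 - x ∈ nonzeroZeroDivisors R := by
    refine ⟨fun h1 => ?_, x, h.ne_zero, by linear_combination -hxx⟩
    obtain ⟨p, hp, hpx, -⟩ := h.exists_mem
    rcases h.mul_self_eq_zero_or p with h0 | h0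
    · exact hp.1 (by linear_combination p * h1 + h0)
    · exact hpx (by linear_combination p * h1 + h0)
  have hne : 1 - x ≠ x := fun h1 => h.ne_zero (by linear_combination -x * h1 - 2 * hxx)
  obtain ⟨q, hq, hqx, -, hq0⟩ := h.exists_mul _ hV hne
  rcases h.mul_self_eq_zero_or q with h0 | h0
  · exact hq.1 (by linear_combination hq0 + h0)
  · exact hqx (by linear_combination hq0 + h0)

theorem add_self (h : IsZeroDivisorSplit x A) : x + x = 0 := by
  rcases h.mul_self_eq_zero_or 2 with h0 | h0
  · linear_combination h0
  · exact absurd (by linear_combination h0) h.ne_zero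

theorem mul_eq_zero (h : IsZeroDivisorSplit x A) {y : R} (hy : y ∈ nonzeroZeroDivisors R) :
    y * x = 0 := by
  by_cases hyx : y = x
  · rw [hyx, h.sq_eq_zero]
  refine (h.mul_self_eq_zero_or y).resolve_right fun hy1 => ?_
  -- If `y * x = x = y * u`, then `y` kills `u - x`, which is thus opposite to `u`. So `u * (u - x)
  -- = x`, and multiplying by `y` gives `y * x = 0`.
  obtain ⟨u, hu, hux, hyu⟩ := h.exists_opposite y
  have huy := h.mul_opposite hy hyx hu hux hyu
  have hxx := h.sq_eq_zero
  have hux0 : u * x = 0 := by linear_combination x * huy - u * hy1 + hxx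
  have hyz : y * (u - x) = 0 := by linear_combination huy - hy1
  have hzV : u - x ∈ nonzeroZeroDivisors R :=
    ⟨sub_ne_zero.2 hux, y, hy.1, by rw [mul_comm]; exact hyz⟩
  have hzx : u - x ≠ x := fun hz => hu.1 (by linear_combination hz + h.add_self)
  have h1 := h.iff_of_mul y hy hyx _ hzV hzx hyz
  have h2 := h.mul_opposite hu hux hzV hzx (by tauto)
  exact h.ne_zero (by linear_combination (-y) * h2 - hy1 + u * hyz)

/-! ### Twins and collisions of representations. -/

theorem add_mem (h : IsZeroDivisorSplit x A) {p : R} (hp : p ∈ nonzeroZeroDivisors R)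
    (hpx : p ≠ x) : p + x ∈ nonzeroZeroDivisors R :=
  ⟨fun h0 => hpx (by linear_combination h0 - h.add_self), x, h.ne_zero,
    by linear_combination h.mul_eq_zero hp + h.sq_eq_zero⟩

theorem add_mul (h : IsZeroDivisorSplit x A) {p b : R} (hb : b ∈ nonzeroZeroDivisors R) :
    (p + x) * b = p * b := by
  linear_combination h.mul_eq_zero hb

theorem iff_add (h : IsZeroDivisorSplit x A) {p : R} (hp : p ∈ nonzeroZeroDivisors R)
    (hpx : p ≠ x) : A p ↔ A (p + x) := by
  obtain ⟨q, hq, hqx, -, hpq⟩ := h.exists_mul p hp hpx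
  exact (h.iff_of_mul p hp hpx q hq hqx hpq).trans
    (h.iff_of_mul _ (h.add_mem hp hpx) (by simpa using hp.1) q hq hqx
      ((h.add_mul hq).trans hpq)).symm

/-- The annihilator of a vertex `c ≠ x` has, besides `0` and `x`, at most two elements. -/
theorem eq_or_eq_add (h : IsZeroDivisorSplit x A) {a u c : R}
    (ha : a ∈ nonzeroZeroDivisors R) (hax : a ≠ x) (hu : u ∈ nonzeroZeroDivisors R) (hux : u ≠ x)
    (hc : c ∈ nonzeroZeroDivisors R) (hcx : c ≠ x) (hca : c * a = 0) (hcu : c * u = 0) :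
    u = a ∨ u = a + x := by
  obtain ⟨w, hw, hwx, hcw⟩ := h.exists_opposite c
  have h1 := h.iff_of_mul c hc hcx a ha hax hca
  have h2 := h.iff_of_mul c hc hcx u hu hux hcu
  have haw := h.mul_opposite ha hax hw hwx (by tauto)
  have huw := h.mul_opposite hu hux hw hwx (by tauto)
  rcases h.eq_zero_or_eq (z := u - a) hc hcx hw hwx hcw (by linear_combination hcu - hca)
    (by linear_combination huw - haw) with h0 | h0
  · exact .inl (by linear_combination h0)
  · exact .inr (by linear_combination h0)

/-- Two vertices, both inside or both outside `B`, have the same multiset representation as soon as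
they annihilate the same elements of `B` among those different from `x` and from both. -/
theorem multisetRep_eq (h : IsZeroDivisorSplit x A) (hx : x ∈ nonzeroZeroDivisors R)
    {B : Finset (nonzeroZeroDivisors R)} {s t : nonzeroZeroDivisors R} (hst : s ≠ t)
    (hB : s ∈ B ↔ t ∈ B)
    (hb : ∀ b ∈ B, b ≠ s → b ≠ t → (b : R) ≠ x → ((s : R) * b = 0 ↔ (t : R) * b = 0)) :
    (zeroDivisorGraph R).multisetRep B s = (zeroDivisorGraph R).multisetRep B t := by
  refine SimpleGraph.multisetRep_eq_of_dist_eq hst hB fun b hbB hbs hbt => ?_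
  refine SimpleGraph.dist_eq_dist_of_adj_iff (z := ⟨x, hx⟩) (fun v hv => ⟨hv.symm, ?_⟩)
    hbs.symm hbt.symm ?_
  · rw [mul_comm]
    exact h.mul_eq_zero v.2
  · simp only [zeroDivisorGraph, ne_eq, hbs.symm, hbt.symm, not_false_eq_true, true_and]
    by_cases hbx : (b : R) = x
    · simp [hbx, h.mul_eq_zero s.2, h.mul_eq_zero t.2]
    · exact hb b hbB hbs hbt hbx

theorem not_isMultisetResolving (h : IsZeroDivisorSplit x A) (hx : x ∈ nonzeroZeroDivisors R)
    (B : Finset (nonzeroZeroDivisors R)) : ¬ (zeroDivisorGraph R).IsMultisetResolving B := by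
  intro hB
  have pair : ∀ (p : R) (hp : p ∈ nonzeroZeroDivisors R) (hpx : p ≠ x),
      ¬ (⟨p, hp⟩ ∈ B ↔ ⟨p + x, h.add_mem hp hpx⟩ ∈ B) := by
    intro p hp hpx hiff
    have hne : (⟨p, hp⟩ : nonzeroZeroDivisors R) ≠ ⟨p + x, h.add_mem hp hpx⟩ := fun h0 =>
      h.ne_zero (by simpa using congrArg Subtype.val h0)
    refine hB _ _ hne (h.multisetRep_eq hx hne hiff fun b _ _ _ _ => ?_)
    rw [h.add_mul b.2]
  have choice : ∀ p ∈ nonzeroZeroDivisors R, p ≠ x → ∃ s : nonzeroZeroDivisors R,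
      s ∈ B ∧ ((s : R) = p ∨ (s : R) = p + x) ∧ (s : R) ≠ x := by
    intro p hp hpx
    by_cases hpB : ⟨p, hp⟩ ∈ B
    · exact ⟨_, hpB, .inl rfl, hpx⟩
    · exact ⟨_, by have := pair p hp hpx; tauto, .inr rfl, by simpa using hp.1⟩
  have unique : ∀ s ∈ B, (s : R) ≠ x → ∀ b ∈ B, (b : R) = s ∨ (b : R) = s + x → b = s := by
    intro s hs hsx b hb hbs
    refine hbs.elim Subtype.ext fun hb' => absurd ?_ (pair s s.2 hsx)
    have : b = ⟨s + x, h.add_mem s.2 hsx⟩ := Subtype.ext hb'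
    exact iff_of_true hs (this ▸ hb)
  -- If all squares vanish, `s` kills only `0`, `x`, `s`, `s + x`, so it has no neighbour in `B`
  -- except possibly `x`; representatives from opposite sides then collide.
  by_cases hsq : ∀ c ∈ nonzeroZeroDivisors R, c ≠ x → c * c = 0
  · obtain ⟨u, hu, hux, -⟩ := h.exists_mem
    obtain ⟨w, hw, hwx, huw⟩ := h.exists_opposite u
    obtain ⟨s, hsB, hs, hsx⟩ := choice u hu hux
    obtain ⟨t, htB, ht, htx⟩ := choice w hw hwx
    have hsu : A s ↔ A u := by
      rcases hs with hs | hs <;> rw [hs]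
      exact (h.iff_add hu hux).symm
    have htw : A t ↔ A w := by
      rcases ht with ht | ht <;> rw [ht]
      exact (h.iff_add hw hwx).symm
    have hst : s ≠ t := by
      rintro rfl
      tauto
    refine hB s t hst (h.multisetRep_eq hx hst (iff_of_true hsB htB) fun b hbB hbs hbt hbx => ?_)
    refine iff_of_false (fun h0 => hbs ?_) (fun h0 => hbt ?_)
    · exact unique s hsB hsx b hbB
        (h.eq_or_eq_add s.2 hsx b.2 hbx s.2 hsx (hsq s s.2 hsx) h0)
    · exact unique t htB htx b hbB
        (h.eq_or_eq_add t.2 htx b.2 hbx t.2 htx (hsq t t.2 htx) h0)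
  · push Not at hsq
    -- Here the representatives of `c` and of a neighbour `a` are adjacent, and each is the other's
    -- only neighbour in `B` apart from `x`.
    obtain ⟨c, hc, hcx, hcc⟩ := hsq
    obtain ⟨a, ha, hax, -, hca⟩ := h.exists_mul c hc hcx
    obtain ⟨s, hsB, hs, hsx⟩ := choice c hc hcx
    obtain ⟨t, htB, ht, htx⟩ := choice a ha hax
    have hmul_s : ∀ b ∈ nonzeroZeroDivisors R, (s : R) * b = c * b := by
      intro b hb
      rcases hs with hs | hs <;> rw [hs]
      exact h.add_mul hb
    have hmul_t : ∀ b ∈ nonzeroZeroDivisors R, (t : R) * b = a * b := by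
      intro b hb
      rcases ht with ht | ht <;> rw [ht]
      exact h.add_mul hb
    have hts : (t : R) * s = 0 := by
      rw [hmul_t s s.2, mul_comm, hmul_s a ha, hca]
    have hst : s ≠ t := by
      rintro rfl
      apply hcc
      rw [← hmul_s c hc, hmul_t c hc, mul_comm, hca]
    refine hB s t hst (h.multisetRep_eq hx hst (iff_of_true hsB htB) fun b hbB hbs hbt hbx => ?_)
    refine iff_of_false (fun h0 => hbt ?_) (fun h0 => hbs ?_)
    · exact unique t htB htx b hbB
        (h.eq_or_eq_add t.2 htx b.2 hbx s.2 hsx (by rw [mul_comm]; exact hts) h0)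
    · exact unique s hsB hsx b hbB (h.eq_or_eq_add s.2 hsx b.2 hbx t.2 htx hts h0)

end IsZeroDivisorSplit

/-- A cut vertex of a zero-divisor graph without vertices of degree one yields a splitting. -/
theorem exists_isZeroDivisorSplit {R : Type*} [CommRing R] [Finite R]
    {x : nonzeroZeroDivisors R} (hcut : (zeroDivisorGraph R).IsCutVertex x)
    (hdeg : ∀ v, ((zeroDivisorGraph R).neighborSet v).ncard ≠ 1) :
    ∃ A : R → Prop, IsZeroDivisorSplit (x : R) A := by
  obtain ⟨hconn, hpre⟩ := hcut
  unfold SimpleGraph.Preconnected at hpre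
  push Not at hpre
  obtain ⟨u, w, huw⟩ := hpre
  have mem : ∀ p : nonzeroZeroDivisors R, (p : R) ≠ x → p ∈ ({x}ᶜ : Set _) :=
    fun p hp hpx => hp (congrArg Subtype.val hpx)
  have hval : ∀ p : ({x}ᶜ : Set (nonzeroZeroDivisors R)), (p : R) ≠ x :=
    fun p hp => p.2 (Subtype.ext hp)
  refine ⟨fun p => ∃ (hp : p ∈ nonzeroZeroDivisors R) (hpx : p ≠ x),
    ((zeroDivisorGraph R).induce {x}ᶜ).Reachable u ⟨⟨p, hp⟩, mem ⟨p, hp⟩ hpx⟩,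
    x.2.1, ?_, ⟨u, u.1.2, hval u, u.1.2, hval u, .refl u⟩,
    ⟨w, w.1.2, hval w, fun ⟨_, _, hw⟩ => huw hw⟩, ?_⟩
  · have key : ∀ p (hp : p ∈ nonzeroZeroDivisors R) (hpx : p ≠ x) q
        (hq : q ∈ nonzeroZeroDivisors R) (hqx : q ≠ x), p * q = 0 →
        ((zeroDivisorGraph R).induce {x}ᶜ).Reachable u ⟨⟨p, hp⟩, mem ⟨p, hp⟩ hpx⟩ →
        ((zeroDivisorGraph R).induce {x}ᶜ).Reachable u ⟨⟨q, hq⟩, mem ⟨q, hq⟩ hqx⟩ := by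
      intro p hp hpx q hq hqx hpq hr
      by_cases hne : p = q
      · subst hne
        exact hr
      · exact hr.trans (SimpleGraph.Adj.reachable
          ⟨fun h0 => hne (congrArg Subtype.val h0), hpq⟩)
    intro p hp hpx q hq hqx hpq
    exact ⟨fun ⟨_, _, hr⟩ => ⟨hq, hqx, key p hp hpx q hq hqx hpq hr⟩,
      fun ⟨_, _, hr⟩ => ⟨hp, hpx, key q hq hqx p hp hpx (by rw [mul_comm]; exact hpq) hr⟩⟩
  · intro p hp hpx
    -- Connectedness excludes degree 0, so the degree is at least 2 and some neighbour differs from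
    -- `x`.
    have hne : ((zeroDivisorGraph R).neighborSet ⟨p, hp⟩).Nonempty := by
      obtain ⟨walk⟩ := hconn.preconnected ⟨p, hp⟩ x
      cases walk with
      | nil => exact absurd rfl hpx
      | cons hadj _ => exact ⟨_, hadj⟩
    have hpos := (Set.ncard_pos (Set.toFinite _)).2 hne
    have hone := hdeg ⟨p, hp⟩
    obtain ⟨q, hq, hqx⟩ := Set.exists_ne_of_one_lt_ncard
      (show 1 < ((zeroDivisorGraph R).neighborSet ⟨p, hp⟩).ncard by omega) x
    exact ⟨q, q.2, fun h0 => hqx (Subtype.ext h0),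
      fun h0 => hq.1 (Subtype.ext h0.symm), hq.2⟩

theorem corollary3p1 (R : Type*) [CommRing R] [Finite R]
    (hcard : 3 ≤ (nonzeroZeroDivisors R).ncard)
    (hcut : ∃ v, (zeroDivisorGraph R).IsCutVertex v)
    (hdeg : ∀ v, ((zeroDivisorGraph R).neighborSet v).ncard ≠ 1) :
    (zeroDivisorGraph R).multisetDim = ⊤ := by
  obtain ⟨x, hx⟩ := hcut
  obtain ⟨A, hA⟩ := exists_isZeroDivisorSplit hx hdeg
  rw [SimpleGraph.multisetDim, sInf_eq_top]
  rintro _ ⟨B, hB, -⟩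
  exact absurd hB (hA.not_isMultisetResolving x.2 B)
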